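/- Let $F=\mathbb{F}_q$ be a finite field of characteristic $2$, let $\omega=\exp(2\pi i/2)=-1$ and let $\operatorname{tr}:F\to\mathbb{F}_2$ be the trace. For $n\ge 1$ let $V_n=\mathbb{C}^{q^n}=(\mathbb{C}^q)^{\otimes n}$ with orthonormal basis $|c\rangle$, $c\in F^n$, and for $a,b\in F^n$ let $X(a)|c\rangle=|c+a\rangle$ and $Z(b)|c\rangle=\prod_{i}\omega^{\operatorname{tr}(b_ic_i)}|c\rangle$. The error group is $G_n=\{\omega^{s}X(a)Z(b): a,b\in F^n,\ s\in\mathbb{F}_2\}$, and the weight of $\omega^sX(a)Z(b)$ is the number of $i$ with $(a_i,b_i)\ne(0,0)$. A subspace $Q\subseteq V_n$ detects $t$ errors if $\langle u|e|v\rangle=0$ for all $u,v\in Q$ with $\langle u|v\rangle=0$ and all $e\in G_n$ of weight at most $t$. An $[[n,\kappa,d]]_q$ quantum code is a subspace $Q\subseteq V_n$ of dimension $q^{\kappa}>1$ with minimum distance $d\ge 1$, i.e. $Q$ detects $d-1$ errors but does not detect $d$ errors; it is a quantum MDS code if $2d=n-\kappa+2$. (1) Let $q=2^m$ with $m>1$.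 For every integer $k$ with $\frac{q+2}{2}\le k\le q+1$ there exists a $[[q+1,\,2k-q-1,\,q-k+2]]_q$ quantum MDS code. (2) Let $l=2^s$ with $s\ge 1$ and let $q=l^2$. Then there exists an $[[l^2+1,\,l^2-2l+3,\,l]]_{q}$ quantum MDS code; that is, there is a quantum MDS code over the alphabet $\mathbb{F}_{l^2}$ of length $l^2+1$ and minimum distance $l$. -/

import Mathlib

open scoped InnerProductSpace

namespace QuantumMDS

/-- The state space `V_n = ℂ^{q^n} = ℂ^q ⊗ ⋯ ⊗ ℂ^q` of `n` qudits with labels in `F = 𝔽_q`: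
the Hilbert space whose standard orthonormal basis `|c⟩` is indexed by the words `c ∈ F^n`. -/
abbrev StateSpace (F : Type*) [Fintype F] (n : ℕ) : Type _ :=
  EuclideanSpace ℂ (Fin n → F)

/-- The primitive `p`-th root of unity `ω = exp(2πi/p)`. -/
noncomputable def omega (p : ℕ) : ℂ :=
  Complex.exp (2 * Real.pi * Complex.I / p)

/-- `ω^c` for `c ∈ 𝔽_p`. -/
noncomputable def omegaPow (p : ℕ) (c : ZMod p) : ℂ :=
  omega p ^ c.val

/-- `X(a) = X(a₁) ⊗ ⋯ ⊗ X(aₙ)`, which sends `|c⟩` to `|c + a⟩`. -/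
noncomputable def opX {F : Type*} [Field F] [Fintype F] {n : ℕ} (a : Fin n → F) :
    StateSpace F n →ₗ[ℂ] StateSpace F n where
  toFun v := WithLp.toLp 2 fun c => v (c - a)
  map_add' _ _ := rfl
  map_smul' _ _ := rfl

/-- `Z(b) = Z(b₁) ⊗ ⋯ ⊗ Z(bₙ)`, which sends `|c⟩` to `∏ᵢ ω^{tr(bᵢ cᵢ)} |c⟩`, where `tr` is the
trace map from `F` to its prime field `𝔽_p`. -/
noncomputable def opZ (p : ℕ) {F : Type*} [Field F] [Fintype F] [Algebra (ZMod p) F] {n : ℕ}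
    (b : Fin n → F) : StateSpace F n →ₗ[ℂ] StateSpace F n where
  toFun v := WithLp.toLp 2 fun c =>
    (∏ i, omegaPow p (Algebra.trace (ZMod p) F (b i * c i))) * v c
  map_add' u v := by
    ext c
    exact mul_add _ (u c) (v c)
  map_smul' r v := by
    ext c
    exact mul_left_comm _ r (v c)

/-- The element `ω^s X(a) Z(b)` of the error group `G_n`. -/
noncomputable def errorOp (p : ℕ) {F : Type*} [Field F] [Fintype F] [Algebra (ZMod p) F] {n : ℕ}
    (s : ZMod p) (a b : Fin n → F) : StateSpace F n →ₗ[ℂ] StateSpace F n :=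
  omegaPow p s • (opX a ∘ₗ opZ p b)

/-- The quantum weight of `ω^s X(a) Z(b)`: the number of qudits on which the error acts by a
non-identity operator `X(aᵢ) Z(bᵢ)`. -/
noncomputable def errorWeight {F : Type*} [Zero F] {n : ℕ} (a b : Fin n → F) : ℕ :=
  {i : Fin n | a i ≠ 0 ∨ b i ≠ 0}.ncard

/-- `Q` detects `t` quantum digits of errors: `⟨u|e|v⟩ = 0` for all orthogonal `u, v ∈ Q` and all
`e ∈ G_n` of quantum weight at most `t`. -/
def Detects (p : ℕ) {F : Type*} [Field F] [Fintype F] [Algebra (ZMod p) F] {n : ℕ}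
    (Q : Submodule ℂ (StateSpace F n)) (t : ℕ) : Prop :=
  ∀ u ∈ Q, ∀ v ∈ Q, ⟪u, v⟫_ℂ = 0 → ∀ (s : ZMod p) (a b : Fin n → F),
    errorWeight a b ≤ t → ⟪u, errorOp p s a b v⟫_ℂ = 0

/-- `Q` is an `[[n, κ, d]]_q` quantum code, `q = |F|`: it is a subspace of `V_n` of dimension
`K = q^κ > 1` whose minimum distance is `d ≥ 1`, that is, `Q` detects `d - 1` digits of errors but
not `d`. -/
structure IsQuantumCode (p : ℕ) {F : Type*} [Field F] [Fintype F] [Algebra (ZMod p) F] {n : ℕ}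
    (Q : Submodule ℂ (StateSpace F n)) (κ d : ℕ) : Prop where
  one_lt_finrank : 1 < Module.finrank ℂ Q
  finrank_eq : Module.finrank ℂ Q = Fintype.card F ^ κ
  one_le_dist : 1 ≤ d
  detects : Detects p Q (d - 1)
  not_detects : ¬ Detects p Q d

/-- `Q` is an `[[n, κ, d]]_q` quantum MDS code: an `[[n, κ, d]]_q` quantum code that attains the
quantum Singleton bound, `2d = n - κ + 2`. -/
structure IsQuantumMDSCode (p : ℕ) {F : Type*} [Field F] [Fintype F] [Algebra (ZMod p) F] {n : ℕ}
    (Q : Submodule ℂ (StateSpace F n)) (κ d : ℕ) : Prop extends IsQuantumCode p Q κ d where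
  singleton_eq : (2 * d : ℤ) = n - κ + 2

end QuantumMDS

namespace QuantumMDS

/-! The codes are stabilizer codes. Up to sign, `X(a)Z(b)` and `X(a')Z(b')` commute, with sign the
trace character of the symplectic form `a·b' + b·a'`. Let `U` be an `F`-space of pairs `(A u, B u)`
of dimension `2D` that is isotropic for this form and in which a pair vanishing on any `D` positions
is zero. Isotropy allows phases `χ` making `u ↦ χ(u) X(A u)Z(B u)` a representation; its fixed space
`Q` has dimension `q^(n-2D)` by a trace computation (`finrank_stabilizerCode`).

An error outside the symplectic complement of `U` has zero matrix elements on `Q`. The MDS property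
leaves only the zero pair in the complement with weight at most `D`, so `Q` detects `D` errors.
Dimension counting gives a nonzero complement vector of weight at most `D + 1`; as `2D < n` it lies
outside `U`, so it acts on `Q` as a non-scalar and is not detected. Hence `d = D + 1`, meeting the
Singleton bound.

It remains to find `U` for `n = q + 1` and `2D ≤ q`, by evaluating polynomials on the projective
line. If `2D < q`, take independent pairs of degree less than `D`, weighted by the values of a
rootless polynomial of degree `q + 1 - 2D`. If `2D = q` that polynomial would be linear and have a
root; instead take pairs of degree at most `D` whose two lowest coefficients are coupled through a
rootless quadratic. Both claims are then instances. -/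

theorem eq_zero_or_eq_one (a : ZMod 2) : a = 0 ∨ a = 1 := by
  revert a
  decide

/-! ### Signs and quartic phases attached to forms over 𝔽₂. -/

theorem omegaPow_two_one : omegaPow 2 1 = -1 := by
  have h : (1 : ZMod 2).val = 1 := rfl
  rw [omegaPow, omega, h, pow_one, ← Complex.exp_pi_mul_I]
  congr 1
  push_cast
  ring

theorem omegaPow_two_zero : omegaPow 2 0 = 1 := by
  simp [omegaPow]

theorem omegaPow_two_add (a b : ZMod 2) :
    omegaPow 2 (a + b) = omegaPow 2 a * omegaPow 2 b := by
  have h : (1 + 1 : ZMod 2) = 0 := rfl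
  rcases eq_zero_or_eq_one a with rfl | rfl <;> rcases eq_zero_or_eq_one b with rfl | rfl <;>
    simp [omegaPow_two_one, omegaPow_two_zero, h]

theorem omegaPow_two_sum {ι : Type*} (s : Finset ι) (f : ι → ZMod 2) :
    omegaPow 2 (∑ i ∈ s, f i) = ∏ i ∈ s, omegaPow 2 (f i) := by
  classical
  induction s using Finset.induction_on with
  | empty => simp [omegaPow_two_zero]
  | insert a s ha ih => rw [Finset.sum_insert ha, Finset.prod_insert ha, omegaPow_two_add, ih]

theorem omegaPow_two_mul_self (a : ZMod 2) : omegaPow 2 a * omegaPow 2 a = 1 := by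
  rw [← omegaPow_two_add, CharTwo.add_self_eq_zero, omegaPow_two_zero]

theorem omegaPow_two_of_ne_zero {a : ZMod 2} (h : a ≠ 0) : omegaPow 2 a = -1 := by
  rw [(eq_zero_or_eq_one a).resolve_left h, omegaPow_two_one]

theorem conj_omegaPow_two (a : ZMod 2) :
    (starRingEnd ℂ) (omegaPow 2 a) = omegaPow 2 a := by
  rcases eq_zero_or_eq_one a with rfl | rfl <;> simp [omegaPow_two_one, omegaPow_two_zero]

theorem omegaPow_two_intCast (k : ℤ) : omegaPow 2 (k : ZMod 2) = (-1) ^ k := by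
  rcases Int.even_or_odd k with h | h
  · rw [h.neg_one_zpow, (ZMod.intCast_zmod_eq_zero_iff_dvd k 2).2 (by exact_mod_cast h.two_dvd),
      omegaPow_two_zero]
  · obtain ⟨j, rfl⟩ := h
    have h2 : (2 : ZMod 2) = 0 := rfl
    rw [Odd.neg_one_zpow ⟨j, rfl⟩]
    push_cast
    rw [h2, zero_mul, zero_add, omegaPow_two_one]

/-- A symmetric bilinear form over `𝔽₂` has a quadratic refinement with values in the fourth roots
of unity. -/
theorem exists_quadratic_refinement {V : Type*} [AddCommGroup V] [Module (ZMod 2) V]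
    [Module.Finite (ZMod 2) V] (β : V →ₗ[ZMod 2] V →ₗ[ZMod 2] ZMod 2)
    (hβ : ∀ x y, β x y = β y x) :
    ∃ χ : V → ℂ, χ 0 = 1 ∧
      ∀ x y, χ (x + y) = χ x * χ y * omegaPow 2 (β x y) := by
  classical
  let b := Module.finBasis (ZMod 2) V
  let lift : V → (Fin (Module.finrank (ZMod 2) V) → ℤ) := fun x i => ((b.repr x i).val : ℤ)
  let M : Matrix (Fin (Module.finrank (ZMod 2) V)) (Fin (Module.finrank (ZMod 2) V)) ℤ :=
    Matrix.of fun i j => ((β (b i) (b j)).val : ℤ)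
  let B := Matrix.toBilin' M
  have hBapp : ∀ u v, B u v = ∑ i, ∑ j, u i * M i j * v j := fun u v => Matrix.toBilin'_apply M u v
  have hBsymm : ∀ u v, B u v = B v u := by
    intro u v
    rw [hBapp, hBapp, Finset.sum_comm]
    refine Finset.sum_congr rfl fun i _ => Finset.sum_congr rfl fun j _ => ?_
    have : M j i = M i j := by simp only [M, Matrix.of_apply, hβ (b j) (b i)]
    rw [this]
    ring
  have hBβ : ∀ x y, ((B (lift x) (lift y) : ℤ) : ZMod 2) = β x y := by
    intro x y
    rw [hBapp, ← LinearMap.sum_repr_mul_repr_mul b b x y, Finsupp.sum_fintype]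
    · push_cast
      refine Finset.sum_congr rfl fun i _ => ?_
      rw [Finsupp.sum_fintype]
      · refine Finset.sum_congr rfl fun j _ => ?_
        simp only [lift, M, Matrix.of_apply, Int.cast_natCast, ZMod.natCast_zmod_val, smul_eq_mul]
        ring
      · simp
    · simp
  have hlift : ∀ x y, ∃ z, lift (x + y) = lift x + lift y - (2 : ℤ) • z := by
    intro x y
    have : ∀ i, ∃ z : ℤ, lift (x + y) i = lift x i + lift y i - 2 * z := by
      intro i
      have h : ((lift x i + lift y i : ℤ) : ZMod 2) = ((lift (x + y) i : ℤ) : ZMod 2) := by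
        simp [lift]
      obtain ⟨z, hz⟩ := (ZMod.intCast_eq_intCast_iff_dvd_sub _ _ 2).1 h
      refine ⟨-z, ?_⟩
      push_cast at hz
      linarith
    choose z hz using this
    exact ⟨z, funext fun i => by simpa using hz i⟩
  -- Lift coordinates to 0 and 1 in ℤ. Moving a lift by `2z` changes the integral quadratic form
  -- only modulo 4 when the form is even there, as it is by symmetry of `B`; the cross term `2 B(x,
  -- y)` gives the sign.
  refine ⟨fun x => Complex.I ^ (B (lift x) (lift x)), ?_, fun x y => ?_⟩
  · have : lift 0 = 0 := by
      funext i
      simp [lift]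
    simp [this]
  · obtain ⟨z, hz⟩ := hlift x y
    have h4 : B (lift (x + y)) (lift (x + y)) = B (lift x) (lift x) + B (lift y) (lift y) +
        2 * B (lift x) (lift y) + 4 * (B z z - B (lift x) z - B (lift y) z) := by
      rw [hz]
      simp only [map_add, map_sub, map_smul, LinearMap.add_apply, LinearMap.sub_apply,
        LinearMap.smul_apply, smul_eq_mul]
      rw [hBsymm z (lift x), hBsymm z (lift y), hBsymm (lift y) (lift x)]
      ring
    have hI : Complex.I ≠ 0 := Complex.I_ne_zero
    have hI2 : Complex.I ^ (2 : ℤ) = -1 := by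
      exact_mod_cast Complex.I_sq
    have hI4 : Complex.I ^ (4 : ℤ) = 1 := by
      exact_mod_cast Complex.I_pow_four
    rw [← hBβ, omegaPow_two_intCast]
    simp only [h4, zpow_add₀ hI, zpow_mul, hI2, hI4, one_zpow, mul_one]

/-! ### Commutation, unitarity and traces of the operators `X(a)Z(b)`. -/

section Pauli

variable {F : Type*} [Field F] [Algebra (ZMod 2) F]

/-- The additive character `x ↦ (-1)^{tr x}` of `F`. -/
noncomputable def traceSign (x : F) : ℂ :=
  omegaPow 2 (Algebra.trace (ZMod 2) F x)

theorem traceSign_add (x y : F) : traceSign (x + y) = traceSign x * traceSign y := by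
  rw [traceSign, map_add, omegaPow_two_add]
  rfl

theorem traceSign_zero : traceSign (0 : F) = 1 := by
  rw [traceSign, map_zero, omegaPow_two_zero]

theorem traceSign_mul_self (x : F) : traceSign x * traceSign x = 1 :=
  omegaPow_two_mul_self _

theorem conj_traceSign (x : F) : (starRingEnd ℂ) (traceSign x) = traceSign x :=
  conj_omegaPow_two _

variable [Fintype F] {n : ℕ}

/-- The operator `X(a) Z(b)`. -/
noncomputable def pauli (a b : Fin n → F) : StateSpace F n →ₗ[ℂ] StateSpace F n :=
  opX a ∘ₗ opZ 2 b

theorem exists_traceSign_mul_eq_neg_one {x : F} (hx : x ≠ 0) :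
    ∃ y : F, traceSign (y * x) = -1 := by
  have htr := (traceForm_nondegenerate (ZMod 2) F).1 x
  simp_rw [Algebra.traceForm_apply] at htr
  by_contra! h
  refine hx (htr fun y => ?_)
  by_contra hy
  exact h y (omegaPow_two_of_ne_zero (mul_comm x y ▸ hy))

theorem pauli_apply (a b : Fin n → F) (v : StateSpace F n) (c : Fin n → F) :
    pauli a b v c = traceSign (b ⬝ᵥ (c - a)) * v (c - a) := by
  change (∏ i, omegaPow 2 (Algebra.trace (ZMod 2) F (b i * (c - a) i))) * v (c - a) = _
  rw [← omegaPow_two_sum, ← map_sum]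
  rfl

theorem pauli_zero : pauli (0 : Fin n → F) 0 = LinearMap.id := by
  ext v c
  simp [pauli_apply, traceSign_zero]

theorem pauli_comp (a b a' b' : Fin n → F) :
    pauli a b ∘ₗ pauli a' b' = traceSign (b ⬝ᵥ a') • pauli (a + a') (b + b') := by
  ext v c
  have h : b ⬝ᵥ (c - a) = b ⬝ᵥ a' + b ⬝ᵥ (c - (a + a')) := by
    rw [← dotProduct_add]
    congr 1
    abel
  simp only [LinearMap.comp_apply, LinearMap.smul_apply, PiLp.smul_apply, smul_eq_mul, pauli_apply,
    h, add_dotProduct, traceSign_add, sub_sub]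
  ring

theorem pauli_comm (a b a' b' : Fin n → F) (v : StateSpace F n) :
    pauli a b (pauli a' b' v) =
      traceSign (a ⬝ᵥ b' + b ⬝ᵥ a') • pauli a' b' (pauli a b v) := by
  have h1 := LinearMap.congr_fun (pauli_comp a b a' b') v
  have h2 := LinearMap.congr_fun (pauli_comp a' b' a b) v
  simp only [LinearMap.comp_apply, LinearMap.smul_apply] at h1 h2
  rw [h1, h2, smul_smul, traceSign_add, add_comm a' a, add_comm b' b, dotProduct_comm b' a,
    mul_right_comm, traceSign_mul_self, one_mul]

theorem inner_pauli_pauli (a b : Fin n → F) (u v : StateSpace F n) :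
    ⟪pauli a b u, pauli a b v⟫_ℂ = ⟪u, v⟫_ℂ := by
  simp only [PiLp.inner_apply, pauli_apply, RCLike.inner_apply, map_mul, conj_traceSign]
  refine Fintype.sum_equiv (Equiv.subRight a) _ _ fun c => ?_
  rw [Equiv.subRight_apply]
  linear_combination (v (c - a) * (starRingEnd ℂ) (u (c - a))) *
    traceSign_mul_self (b ⬝ᵥ (c - a))

theorem sum_traceSign_dotProduct {b : Fin n → F} (hb : b ≠ 0) :
    ∑ c : Fin n → F, traceSign (b ⬝ᵥ c) = 0 := by
  classical
  obtain ⟨i, hi⟩ := Function.ne_iff.1 hb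
  obtain ⟨y, hy⟩ := exists_traceSign_mul_eq_neg_one hi
  have h := Equiv.sum_comp (Equiv.addRight (Pi.single i y))
    (fun c : Fin n → F => traceSign (b ⬝ᵥ c))
  simp only [Equiv.coe_addRight, dotProduct_add, traceSign_add, dotProduct_single,
    mul_comm (b i) y, hy, mul_neg, mul_one, Finset.sum_neg_distrib] at h
  linear_combination (-1 / 2 : ℂ) * h

/-- For `a ≠ 0` the basis vectors are moved without fixed points, so the diagonal is zero; for `a =
0` the diagonal is a nontrivial character, which sums to zero. -/
theorem trace_pauli_of_ne_zero {a b : Fin n → F} (h : a ≠ 0 ∨ b ≠ 0) :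
    LinearMap.trace ℂ _ (pauli a b) = 0 := by
  classical
  rw [LinearMap.trace_eq_matrix_trace ℂ (EuclideanSpace.basisFun (Fin n → F) ℂ).toBasis,
    Matrix.trace]
  have hd : ∀ c, (LinearMap.toMatrix (EuclideanSpace.basisFun (Fin n → F) ℂ).toBasis
      (EuclideanSpace.basisFun (Fin n → F) ℂ).toBasis (pauli a b)).diag c =
      if a = 0 then traceSign (b ⬝ᵥ c) else 0 := by
    intro c
    rw [Matrix.diag_apply, LinearMap.toMatrix_apply]
    simp only [OrthonormalBasis.coe_toBasis, OrthonormalBasis.coe_toBasis_repr_apply,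
      EuclideanSpace.basisFun_repr, EuclideanSpace.basisFun_apply, pauli_apply]
    split_ifs with ha
    · simp [ha]
    · simp [ha]
  simp only [hd]
  split_ifs with ha
  · exact sum_traceSign_dotProduct (h.resolve_left fun h => h ha)
  · simp

end Pauli

/-! ### Stabilizer codes: dimension, and the action of errors. -/

section Stabilizer

variable {F : Type*} [Field F] [Fintype F] [Algebra (ZMod 2) F] {n : ℕ}
  {U : Type*} [AddCommGroup U] [Module F U]

/-- The operators `χ(u) X(A u) Z(B u)` as a representation of the additive group of `U`. -/
noncomputable def stabilizerRep (A B : U →ₗ[F] (Fin n → F)) (χ : U → ℂ) (h0 : χ 0 = 1)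
    (hadd : ∀ u u', χ (u + u') = χ u * χ u' * traceSign (B u ⬝ᵥ A u')) :
    Representation ℂ (Multiplicative U) (StateSpace F n) where
  toFun g := χ g.toAdd • pauli (A g.toAdd) (B g.toAdd)
  map_one' := by
    rw [toAdd_one, map_zero, map_zero, h0, one_smul, pauli_zero]
    rfl
  map_mul' g g' := by
    rw [toAdd_mul, map_add, map_add, hadd, Module.End.mul_eq_comp, LinearMap.smul_comp,
      LinearMap.comp_smul, pauli_comp, smul_smul, smul_smul]

/-- Phases that turn `u ↦ X(A u) Z(B u)` into a representation, for an isotropic family. -/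
theorem exists_phase [Module.Finite F U] (A B : U →ₗ[F] (Fin n → F))
    (hAB : ∀ u u', A u ⬝ᵥ B u' = B u ⬝ᵥ A u') :
    ∃ χ : U → ℂ, χ 0 = 1 ∧
      ∀ u u', χ (u + u') = χ u * χ u' * traceSign (B u ⬝ᵥ A u') := by
  let _ : Module (ZMod 2) U := Module.compHom U (algebraMap (ZMod 2) F)
  have : Finite U := Module.finite_of_finite F
  have hsmul : ∀ (c : ZMod 2) (u : U), c • u = algebraMap (ZMod 2) F c • u := fun _ _ => rfl
  let β : U →ₗ[ZMod 2] U →ₗ[ZMod 2] ZMod 2 :=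
    LinearMap.mk₂ (ZMod 2) (fun u u' => Algebra.trace (ZMod 2) F (B u ⬝ᵥ A u'))
      (fun u u' v => by rw [map_add, add_dotProduct, map_add])
      (fun c u v => by
        rw [hsmul, map_smul, smul_dotProduct, algebraMap_smul, map_smul])
      (fun u u' v => by rw [map_add, dotProduct_add, map_add])
      (fun c u v => by
        rw [hsmul, map_smul, dotProduct_smul, algebraMap_smul, map_smul])
  have hβ : ∀ x y, β x y = β y x := by
    intro x y
    simp only [β, LinearMap.mk₂_apply]
    rw [← hAB, dotProduct_comm]
  exact exists_quadratic_refinement β hβ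

/-- The code fixed by all operators `χ(u) X(A u) Z(B u)`. -/
noncomputable def stabilizerCode (A B : U →ₗ[F] (Fin n → F)) (χ : U → ℂ) :
    Submodule ℂ (StateSpace F n) :=
  ⨅ u, LinearMap.ker (χ u • pauli (A u) (B u) - LinearMap.id)

theorem mem_stabilizerCode {A B : U →ₗ[F] (Fin n → F)} {χ : U → ℂ} {v : StateSpace F n} :
    v ∈ stabilizerCode A B χ ↔ ∀ u, χ u • pauli (A u) (B u) v = v := by
  simp [stabilizerCode, Submodule.mem_iInf, sub_eq_zero]

/-- The average of the representation over `U` projects onto the code, so its trace is the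
dimension. By `hinj` only `u = 0` contributes, giving `q^n / |U|`. -/
theorem finrank_stabilizerCode [Module.Finite F U] (A B : U →ₗ[F] (Fin n → F)) (χ : U → ℂ)
    (h0 : χ 0 = 1) (hadd : ∀ u u', χ (u + u') = χ u * χ u' * traceSign (B u ⬝ᵥ A u'))
    (hinj : ∀ u, A u = 0 → B u = 0 → u = 0) :
    (Module.finrank ℂ (stabilizerCode A B χ) : ℂ) * (Fintype.card F : ℂ) ^ Module.finrank F U =
      (Fintype.card F : ℂ) ^ n := by
  classical
  have : Finite U := Module.finite_of_finite F
  have : Fintype U := Fintype.ofFinite U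
  let ρ := stabilizerRep A B χ h0 hadd
  have hcard : (Fintype.card (Multiplicative U) : ℂ) = (Fintype.card F : ℂ) ^ Module.finrank F U := by
    rw [Fintype.card_multiplicative, Module.card_eq_pow_finrank (K := F)]
    push_cast
    rfl
  have hne : (Fintype.card (Multiplicative U) : ℂ) ≠ 0 := Nat.cast_ne_zero.2 Fintype.card_ne_zero
  let _ : Invertible (Fintype.card (Multiplicative U) : ℂ) := invertibleOfNonzero hne
  have hρ : ρ.invariants = stabilizerCode A B χ := by
    ext v
    rw [mem_stabilizerCode, Representation.mem_invariants]
    exact Multiplicative.forall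
  have htr := (ρ.isProj_averageMap).trace
  have hsum : LinearMap.trace ℂ _ ρ.averageMap =
      (Fintype.card (Multiplicative U) : ℂ)⁻¹ * (Fintype.card F : ℂ) ^ n := by
    rw [Representation.averageMap, GroupAlgebra.average, map_smul, map_sum, map_smul, map_sum,
      invOf_eq_inv, smul_eq_mul]
    congr 1
    rw [Finset.sum_eq_single 1]
    · rw [MonoidAlgebra.of_apply, Representation.asAlgebraHom_single_one, map_one,
        LinearMap.trace_one]
      simp
    · intro g _ hg
      rw [MonoidAlgebra.of_apply, Representation.asAlgebraHom_single_one]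
      change LinearMap.trace ℂ _ (χ g.toAdd • pauli (A g.toAdd) (B g.toAdd)) = 0
      rw [map_smul, trace_pauli_of_ne_zero, smul_zero]
      by_contra! h
      exact hg (hinj g.toAdd h.1 h.2)
    · simp
  rw [← hρ, ← htr, hsum, ← hcard]
  field_simp

theorem errorOp_eq (s : ZMod 2) (a b : Fin n → F) :
    errorOp 2 s a b = omegaPow 2 s • pauli a b := rfl

/-- Inserting the stabilizer element on both sides multiplies the matrix element by `-|χ(u)|²`.
Since `1 + |χ(u)|²` is positive, `χ` need not be shown unimodular. -/
theorem inner_pauli_eq_zero_of_anticommute {A B : U →ₗ[F] (Fin n → F)} {χ : U → ℂ}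
    {a b : Fin n → F} {u : U}
    (hu : traceSign (A u ⬝ᵥ b + B u ⬝ᵥ a) = -1) {v w : StateSpace F n}
    (hv : v ∈ stabilizerCode A B χ) (hw : w ∈ stabilizerCode A B χ) :
    ⟪v, pauli a b w⟫_ℂ = 0 := by
  have h := pauli_comm (A u) (B u) a b w
  rw [hu, neg_one_smul] at h
  have key : ⟪v, pauli a b w⟫_ℂ = -(starRingEnd ℂ (χ u) * χ u) * ⟪v, pauli a b w⟫_ℂ := by
    conv_lhs => rw [← mem_stabilizerCode.1 hv u, ← mem_stabilizerCode.1 hw u]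
    rw [map_smul, ← neg_eq_iff_eq_neg.2 h, inner_smul_left, inner_smul_right, inner_neg_right,
      inner_pauli_pauli]
    ring
  have hpos : (1 + starRingEnd ℂ (χ u) * χ u) ≠ 0 := by
    rw [← Complex.normSq_eq_conj_mul_self]
    exact_mod_cast (by linarith [Complex.normSq_nonneg (χ u)] : (0 : ℝ) < 1 + Complex.normSq (χ u)).ne'
  refine (mul_eq_zero.1 (?_ : (1 + starRingEnd ℂ (χ u) * χ u) * _ = 0)).resolve_left hpos
  linear_combination key

theorem pauli_mem_stabilizerCode {A B : U →ₗ[F] (Fin n → F)} {χ : U → ℂ}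
    {a b : Fin n → F} (h : ∀ u, A u ⬝ᵥ b + B u ⬝ᵥ a = 0) {v : StateSpace F n}
    (hv : v ∈ stabilizerCode A B χ) : pauli a b v ∈ stabilizerCode A B χ := by
  rw [mem_stabilizerCode] at hv ⊢
  intro u
  rw [pauli_comm, h, traceSign_zero, one_smul, ← map_smul, hv]

/-- A pair of anticommuting operators that preserve a nonzero subspace cannot act on it as errors
that orthogonality detects. -/
theorem exists_inner_pauli_ne_zero {Q : Submodule ℂ (StateSpace F n)} {a b a' b' : Fin n → F}
    (hanti : traceSign (a ⬝ᵥ b' + b ⬝ᵥ a') = -1)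
    (he : ∀ v ∈ Q, pauli a b v ∈ Q) (hf : ∀ v ∈ Q, pauli a' b' v ∈ Q)
    {x : StateSpace F n} (hx : x ∈ Q) (hx0 : x ≠ 0) :
    ∃ v ∈ Q, ∃ w ∈ Q, ⟪v, w⟫_ℂ = 0 ∧ ⟪v, pauli a b w⟫_ℂ ≠ 0 := by
  by_contra! hdet
  -- The part `w` of the image of `v` orthogonal to `v` lies in `Q`; detection applied to `w` and
  -- `v` gives `⟨w, w⟩ = 0`.
  have heig : ∀ v ∈ Q, v ≠ 0 → ∃ c : ℂ, pauli a b v = c • v := by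
    intro v hv hv0
    have hvv : ⟪v, v⟫_ℂ ≠ 0 := inner_self_ne_zero.2 hv0
    set c : ℂ := ⟪v, pauli a b v⟫_ℂ / ⟪v, v⟫_ℂ with hc
    set w := pauli a b v - c • v with hw
    have hwQ : w ∈ Q := Q.sub_mem (he v hv) (Q.smul_mem c hv)
    have hvw : ⟪v, w⟫_ℂ = 0 := by
      rw [hw, inner_sub_right, inner_smul_right, hc, div_mul_cancel₀ _ hvv, sub_self]
    have hwv : ⟪w, v⟫_ℂ = 0 := inner_eq_zero_symm.1 hvw
    have h := hdet w hwQ v hv hwv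
    refine ⟨c, sub_eq_zero.1 (inner_self_eq_zero (𝕜 := ℂ).1 ?_)⟩
    change ⟪w, w⟫_ℂ = 0
    conv_lhs => rw [hw, inner_sub_right, inner_smul_right, ← hw, h, hwv, mul_zero, sub_zero]
  have hne : ∀ (a b : Fin n → F) (v : StateSpace F n), v ≠ 0 → pauli a b v ≠ 0 := by
    intro a b v hv h
    apply hv
    rw [← inner_self_eq_zero (𝕜 := ℂ), ← inner_pauli_pauli a b, h, inner_zero_left]
  obtain ⟨c, hc⟩ := heig x hx hx0
  set y := pauli a' b' x with hy
  have hyQ : y ∈ Q := hf x hx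
  have hy0 : y ≠ 0 := hne _ _ _ hx0
  have hcy : pauli a b y = -(c • y) := by
    rw [hy, pauli_comm, hanti, hc, neg_one_smul, map_smul]
  have hc0 : c ≠ 0 := by
    rintro rfl
    exact hne a b x hx0 (by rw [hc, zero_smul])
  -- `x` and `y` have the distinct eigenvalues `c` and `-c`, so they are independent and `x + y`
  -- cannot be an eigenvector.
  have hxy : ∀ r : ℂ, x ≠ r • y := by
    intro r h
    have h1 : pauli a b x = -(c • x) := by
      rw [h, map_smul, hcy, smul_neg, smul_comm]
    rw [hc, eq_neg_iff_add_eq_zero, ← add_smul, smul_eq_zero] at h1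
    exact h1.elim (fun h => hc0 (by linear_combination h / 2)) hx0
  have hs0 : x + y ≠ 0 := fun h => hxy (-1) (by rw [neg_one_smul]; exact eq_neg_of_add_eq_zero_left h)
  obtain ⟨r, hr⟩ := heig (x + y) (Q.add_mem hx hyQ) hs0
  rw [map_add, hc, hcy, smul_add] at hr
  have h2 : (c - r) • x = (r + c) • y := by
    rw [sub_smul, add_smul]
    rw [← sub_eq_zero] at hr ⊢
    rw [← hr]
    abel
  by_cases hcr : c - r = 0
  · rw [hcr, zero_smul, eq_comm, smul_eq_zero] at h2
    exact h2.elim (fun h => hc0 (by linear_combination (hcr + h) / 2)) hy0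
  · apply hxy ((c - r)⁻¹ * (r + c))
    rw [mul_smul, ← h2, smul_smul, inv_mul_cancel₀ hcr, one_smul]

end Stabilizer

/-! ### Linear algebra of the symplectic complement. -/

section MDS

variable {F : Type*} [Field F] {n : ℕ} {U : Type*} [AddCommGroup U] [Module F U]

/-- A vector annihilated by the dual of an MDS family, supported on `D` positions, vanishes. -/
theorem eq_zero_of_forall_symplectic_eq_zero [Module.Finite F U] {D : ℕ}
    {A B : U →ₗ[F] (Fin n → F)} (hU : Module.finrank F U = 2 * D) (hD : D ≤ n)
    (hmds : ∀ T : Finset (Fin n), T.card = D → ∀ u, (∀ i ∈ T, A u i = 0 ∧ B u i = 0) → u = 0)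
    {a b : Fin n → F} (hw : errorWeight a b ≤ D) (h : ∀ u, A u ⬝ᵥ b + B u ⬝ᵥ a = 0) :
    a = 0 ∧ b = 0 := by
  classical
  let T0 : Finset (Fin n) := Finset.univ.filter fun i => a i ≠ 0 ∨ b i ≠ 0
  have hT0 : T0.card ≤ D := by
    refine le_trans (le_of_eq ?_) hw
    rw [errorWeight, ← Set.ncard_coe_finset]
    congr 1
    ext i
    simp [T0]
  obtain ⟨T, hT0T, hT⟩ := Finset.exists_superset_card_eq hT0 (by simpa using hD)
  let φ : U →ₗ[F] (T → F) × (T → F) :=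
    ((LinearMap.funLeft F F (Subtype.val : T → Fin n)) ∘ₗ A).prod
      ((LinearMap.funLeft F F (Subtype.val : T → Fin n)) ∘ₗ B)
  have hφ : ∀ u, φ u = (fun i : T => A u i, fun i : T => B u i) := fun _ => rfl
  have hinj : Function.Injective φ := by
    rw [injective_iff_map_eq_zero]
    intro u hu
    rw [hφ, Prod.mk_eq_zero] at hu
    exact hmds T hT u fun i hi => ⟨congrFun hu.1 ⟨i, hi⟩, congrFun hu.2 ⟨i, hi⟩⟩
  -- Both sides have dimension `2D`, so restrictions of `U` to `T` include every unit vector;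
  -- pairing with these isolates each coordinate of `a` and `b`.
  have hsurj : Function.Surjective φ := by
    rw [← LinearMap.injective_iff_surjective_of_finrank_eq_finrank]
    · exact hinj
    · rw [hU, Module.finrank_prod, Module.finrank_fintype_fun_eq_card, Fintype.card_coe, hT, two_mul]
  have hout : ∀ i, i ∉ T → a i = 0 ∧ b i = 0 := by
    intro i hi
    by_contra h
    exact hi (hT0T (by simpa [T0, or_iff_not_and_not] using h))
  have hdot : ∀ u, ∑ i : T, (A u i * b i + B u i * a i) = 0 := by
    intro u
    rw [← h u, dotProduct, dotProduct, ← Finset.sum_add_distrib,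
      Finset.sum_coe_sort T fun i => A u i * b i + B u i * a i]
    refine Finset.sum_subset (Finset.subset_univ T) fun i _ hi => ?_
    simp [hout i hi]
  have hin : ∀ i, i ∈ T → a i = 0 ∧ b i = 0 := by
    intro i hi
    constructor
    · obtain ⟨u, hu⟩ := hsurj (0, Pi.single ⟨i, hi⟩ 1)
      rw [hφ, Prod.mk.injEq] at hu
      have := hdot u
      simp only [fun j : T => congrFun hu.1 j, fun j : T => congrFun hu.2 j] at this
      simpa [Pi.single_apply] using this
    · obtain ⟨u, hu⟩ := hsurj (Pi.single ⟨i, hi⟩ 1, 0)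
      rw [hφ, Prod.mk.injEq] at hu
      have := hdot u
      simp only [fun j : T => congrFun hu.1 j, fun j : T => congrFun hu.2 j] at this
      simpa [Pi.single_apply] using this
  exact ⟨funext fun i => (em (i ∈ T)).elim (fun hi => (hin i hi).1) fun hi => (hout i hi).1,
    funext fun i => (em (i ∈ T)).elim (fun hi => (hin i hi).2) fun hi => (hout i hi).2⟩

/-- A space of dimension `2 D` has a nonzero annihilated vector of weight at most `D + 1`. -/
theorem exists_symplectic_eq_zero_of_weight_le [Module.Finite F U] {D : ℕ}
    {A B : U →ₗ[F] (Fin n → F)} (hU : Module.finrank F U = 2 * D) (hD : D + 1 ≤ n) :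
    ∃ a b : Fin n → F, errorWeight a b ≤ D + 1 ∧ ¬ (a = 0 ∧ b = 0) ∧
      ∀ u, A u ⬝ᵥ b + B u ⬝ᵥ a = 0 := by
  classical
  obtain ⟨T, hT⟩ : ∃ T : Finset (Fin n), T.card = D + 1 := by
    obtain ⟨T, -, hT⟩ := Finset.exists_subset_card_eq (s := (Finset.univ : Finset (Fin n)))
      (n := D + 1) (by simpa using hD)
    exact ⟨T, hT⟩
  let incl : (T → F) →ₗ[F] (Fin n → F) := Function.ExtendByZero.linearMap F Subtype.val
  have hext : ∀ (f : T → F) (i : T), incl f i = f i := fun f i =>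
    Subtype.val_injective.extend_apply f 0 i
  have hincl_out : ∀ (f : T → F) (i : Fin n), i ∉ T → incl f i = 0 := fun f i hi =>
    Function.extend_apply' f (0 : Fin n → F) i (by rintro ⟨j, rfl⟩; exact hi j.2)
  let ψ : (T → F) × (T → F) →ₗ[F] Module.Dual F U :=
    LinearMap.mk₂ F (fun (p : (T → F) × (T → F)) u => A u ⬝ᵥ incl p.2 + B u ⬝ᵥ incl p.1)
      (fun p p' u => by
        simp only [Prod.snd_add, Prod.fst_add, map_add, dotProduct_add]
        ring)
      (fun c p u => by
        simp only [Prod.smul_snd, Prod.smul_fst, map_smul, dotProduct_smul, smul_add])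
      (fun p u u' => by
        simp only [map_add, add_dotProduct]
        ring)
      (fun c p u => by simp only [map_smul, smul_dotProduct, smul_add])
  -- Pairs supported on `T` form a space of dimension `2(D + 1)`, subject to only `2D` conditions.
  have hker : LinearMap.ker ψ ≠ ⊥ := by
    apply LinearMap.ker_ne_bot_of_finrank_lt
    rw [Subspace.dual_finrank_eq, hU, Module.finrank_prod, Module.finrank_fintype_fun_eq_card,
      Fintype.card_coe, hT]
    omega
  obtain ⟨p, hp, hp0⟩ := Submodule.exists_mem_ne_zero_of_ne_bot hker
  refine ⟨incl p.1, incl p.2, ?_, ?_, fun u => LinearMap.congr_fun hp u⟩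
  · rw [← hT, ← Set.ncard_coe_finset, errorWeight]
    refine Set.ncard_le_ncard ?_ (Set.toFinite _)
    intro i hi
    by_contra hiT
    exact hi.elim (fun h => h (hincl_out _ _ hiT)) fun h => h (hincl_out _ _ hiT)
  · rintro ⟨h1, h2⟩
    apply hp0
    refine Prod.ext (funext fun i => ?_) (funext fun i => ?_)
    · rw [← hext p.1 i, h1]
      rfl
    · rw [← hext p.2 i, h2]
      rfl

/-- The symplectic complement of the symplectic complement of a subspace is the subspace. -/
theorem exists_symplectic_ne_zero {A B : U →ₗ[F] (Fin n → F)} {a b : Fin n → F}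
    (h : ¬ ∃ u, A u = a ∧ B u = b) :
    ∃ a' b' : Fin n → F, (∀ u, A u ⬝ᵥ b' + B u ⬝ᵥ a' = 0) ∧ a ⬝ᵥ b' + b ⬝ᵥ a' ≠ 0 := by
  classical
  have hmem : ((a, b) : (Fin n → F) × (Fin n → F)) ∉ LinearMap.range (A.prod B) := by
    rintro ⟨u, hu⟩
    exact h ⟨u, (Prod.mk.inj hu).1, (Prod.mk.inj hu).2⟩
  obtain ⟨f, hf, hfr⟩ := Submodule.exists_le_ker_of_notMem hmem
  have hrep : ∀ x y : Fin n → F, f (x, y) =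
      x ⬝ᵥ (fun i => f (Pi.single i 1, 0)) + y ⬝ᵥ (fun i => f (0, Pi.single i 1)) := by
    intro x y
    have hx := LinearMap.pi_apply_eq_sum_univ (f ∘ₗ LinearMap.inl F _ _) x
    have hy := LinearMap.pi_apply_eq_sum_univ (f ∘ₗ LinearMap.inr F _ _) y
    have hs : ((x, y) : (Fin n → F) × (Fin n → F)) = (x, 0) + (0, y) := by simp
    have hsingle : ∀ i : Fin n, (fun j => if i = j then (1 : F) else 0) = Pi.single i 1 := by
      intro i
      funext j
      simp [Pi.single_apply, eq_comm]
    simp only [LinearMap.comp_apply, LinearMap.inl_apply, LinearMap.inr_apply, smul_eq_mul,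
      hsingle] at hx hy
    rw [hs, map_add, hx, hy]
    rfl
  refine ⟨fun i => f (0, Pi.single i 1), fun i => f (Pi.single i 1, 0), fun u => ?_, ?_⟩
  · rw [← hrep]
    exact hfr ⟨u, rfl⟩
  · rw [← hrep]
    exact hf

end MDS

/-- An isotropic MDS family of pairs of words gives a quantum MDS code. -/
theorem exists_isQuantumMDSCode_of_isotropic {F : Type*} [Field F] [Fintype F] [Algebra (ZMod 2) F]
    {n D : ℕ} {U : Type*} [AddCommGroup U] [Module F U] [Module.Finite F U]
    (A B : U →ₗ[F] (Fin n → F)) (hU : Module.finrank F U = 2 * D) (hD : 2 * D < n)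
    (hAB : ∀ u u', A u ⬝ᵥ B u' = B u ⬝ᵥ A u')
    (hmds : ∀ T : Finset (Fin n), T.card = D → ∀ u, (∀ i ∈ T, A u i = 0 ∧ B u i = 0) → u = 0) :
    ∃ Q : Submodule ℂ (StateSpace F n), IsQuantumMDSCode 2 Q (n - 2 * D) (D + 1) := by
  classical
  obtain ⟨T, -, hT⟩ := Finset.exists_subset_card_eq (s := (Finset.univ : Finset (Fin n)))
      (n := D) (by simp; omega)
  have hinj : ∀ u, A u = 0 → B u = 0 → u = 0 := fun u ha hb =>
    hmds T hT u fun i _ => ⟨congrFun ha i, congrFun hb i⟩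
  obtain ⟨χ, h0, hadd⟩ := exists_phase A B hAB
  have hq : 1 < Fintype.card F := Fintype.one_lt_card
  have hrank : Module.finrank ℂ (stabilizerCode A B χ) = Fintype.card F ^ (n - 2 * D) := by
    have h := finrank_stabilizerCode A B χ h0 hadd hinj
    rw [hU] at h
    have h' : Module.finrank ℂ (stabilizerCode A B χ) * Fintype.card F ^ (2 * D) =
        Fintype.card F ^ n := by exact_mod_cast h
    have h2 : Fintype.card F ^ n = Fintype.card F ^ (n - 2 * D) * Fintype.card F ^ (2 * D) := by
      rw [← pow_add]
      congr 1
      omega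
    rw [h2] at h'
    exact Nat.eq_of_mul_eq_mul_right (by positivity) h'
  have hlt : 1 < Module.finrank ℂ (stabilizerCode A B χ) := by
    rw [hrank]
    exact Nat.one_lt_pow (by omega) hq
  refine ⟨stabilizerCode A B χ, ⟨⟨hlt, hrank, by omega, ?_, ?_⟩, by omega⟩⟩
  · intro v hv w hw hvw s a b hab
    rw [errorOp_eq, LinearMap.smul_apply, inner_smul_right]
    by_cases hS : ∀ u, A u ⬝ᵥ b + B u ⬝ᵥ a = 0
    · obtain ⟨rfl, rfl⟩ :=
        eq_zero_of_forall_symplectic_eq_zero hU (by omega) hmds (by simpa using hab) hS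
      rw [pauli_zero, LinearMap.id_apply, hvw, mul_zero]
    · push Not at hS
      obtain ⟨u, hu⟩ := hS
      obtain ⟨y, hy⟩ := exists_traceSign_mul_eq_neg_one hu
      have hyu : traceSign (A (y • u) ⬝ᵥ b + B (y • u) ⬝ᵥ a) = -1 := by
        rw [map_smul, map_smul, smul_dotProduct, smul_dotProduct, ← smul_add, smul_eq_mul, hy]
      rw [inner_pauli_eq_zero_of_anticommute hyu hv hw, mul_zero]
  · intro hdet
    obtain ⟨a, b, hwt, hab0, hab⟩ :=
      exists_symplectic_eq_zero_of_weight_le (A := A) (B := B) hU (by omega)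
    -- A member of the family of weight at most `D + 1` vanishes on at least `n - D - 1 ≥ D`
    -- positions, hence is zero.
    have hout : ¬ ∃ u, A u = a ∧ B u = b := by
      rintro ⟨u, rfl, rfl⟩
      apply hab0
      let T0 : Finset (Fin n) := Finset.univ.filter fun i => ¬ (A u i ≠ 0 ∨ B u i ≠ 0)
      have hT0 : D ≤ T0.card := by
        have h1 := Finset.card_filter_add_card_filter_not (s := (Finset.univ : Finset (Fin n)))
          (fun i => A u i ≠ 0 ∨ B u i ≠ 0)
        have h2 : (Finset.univ.filter fun i => A u i ≠ 0 ∨ B u i ≠ 0).card =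
            errorWeight (A u) (B u) := by
          rw [errorWeight, ← Set.ncard_coe_finset]
          congr 1
          ext i
          simp
        rw [Finset.card_univ, Fintype.card_fin, h2] at h1
        change D ≤ (Finset.univ.filter fun i => ¬ (A u i ≠ 0 ∨ B u i ≠ 0)).card
        omega
      obtain ⟨T', hT'0, hT'⟩ := Finset.exists_subset_card_eq hT0
      have : u = 0 := hmds T' hT' u fun i hi => by
        have := hT'0 hi
        simpa [T0] using this
      rw [this, map_zero, map_zero]
      exact ⟨rfl, rfl⟩
    obtain ⟨a', b', hS, hne⟩ := exists_symplectic_ne_zero hout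
    obtain ⟨y, hy⟩ := exists_traceSign_mul_eq_neg_one hne
    have hyS : ∀ u, A u ⬝ᵥ (y • b') + B u ⬝ᵥ (y • a') = 0 := fun u => by
      rw [dotProduct_smul, dotProduct_smul, ← smul_add, hS, smul_zero]
    have hy' : traceSign (a ⬝ᵥ (y • b') + b ⬝ᵥ (y • a')) = -1 := by
      rw [dotProduct_smul, dotProduct_smul, ← smul_add, smul_eq_mul, hy]
    have hnt : stabilizerCode A B χ ≠ ⊥ := by
      intro h
      rw [h, finrank_bot] at hlt
      omega
    obtain ⟨x, hx, hx0⟩ := Submodule.exists_mem_ne_zero_of_ne_bot hnt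
    obtain ⟨v, hv, w, hw, hvw, hne⟩ := exists_inner_pauli_ne_zero hy'
      (fun v hv => pauli_mem_stabilizerCode hab hv) (fun v hv => pauli_mem_stabilizerCode hyS hv)
      hx hx0
    have := hdet v hv w hw hvw 0 a b hwt
    rw [errorOp_eq, omegaPow_two_zero, one_smul] at this
    exact hne this

open Polynomial

/-! ### Binary forms on the projective line, and power sums over `F`. -/

section ProjectiveLine

variable {F : Type*} [Field F]

/-- Evaluation of a polynomial of degree at most `N`, viewed as a binary form of degree `N`, at a
point of the projective line `F ∪ {∞}`. -/
noncomputable def evalLine (N : ℕ) : Option F → F[X] →ₗ[F] F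
  | none => lcoeff F N
  | some x => leval x

@[simp]
theorem evalLine_none (N : ℕ) (p : F[X]) : evalLine N none p = p.coeff N := rfl

@[simp]
theorem evalLine_some (N : ℕ) (x : F) (p : F[X]) : evalLine N (some x) p = p.eval x := rfl

theorem eval_eq_zero_of_mem_eraseNone {N : ℕ} {p : F[X]} {T : Finset (Option F)}
    (h : ∀ o ∈ T, evalLine N o p = 0) : ∀ x ∈ Finset.eraseNone T, p.eval x = 0 :=
  fun x hx => h (some x) (Finset.mem_eraseNone.1 hx)

/-- The inequality `hT` treats two cases at once: it says `m ≥ N` if `∞ ∈ T`, where the zero at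
infinity kills the coefficient of degree `N`, and `m > N` otherwise. -/
theorem coeff_eq_zero_of_evalLine_eq_zero {N : ℕ} {p : F[X]} (hp : p.natDegree ≤ N)
    {T : Finset (Option F)} (h : ∀ o ∈ T, evalLine N o p = 0) {m : ℕ}
    (hT : N + (Finset.eraseNone T).card < m + T.card) : p.coeff m = 0 := by
  classical
  by_cases hN : none ∈ T
  · rw [Finset.card_eraseNone_of_mem hN] at hT
    rcases (by omega : m = N ∨ N < m) with rfl | hm
    · exact h none hN
    · exact coeff_eq_zero_of_natDegree_lt (hp.trans_lt hm)
  · rw [Finset.card_eraseNone_of_not_mem hN] at hT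
    exact coeff_eq_zero_of_natDegree_lt (by omega)

/-- A binary form of degree `N` has at most `N` zeros on the projective line. -/
theorem eq_zero_of_evalLine_eq_zero {N : ℕ} {p : F[X]} (hp : p.natDegree ≤ N)
    {T : Finset (Option F)} (hT : N < T.card) (h : ∀ o ∈ T, evalLine N o p = 0) : p = 0 := by
  refine eq_zero_of_degree_lt_of_eval_finset_eq_zero (Finset.eraseNone T) ?_
    (eval_eq_zero_of_mem_eraseNone h)
  rw [degree_lt_iff_coeff_zero]
  exact fun m hm => coeff_eq_zero_of_evalLine_eq_zero hp h (by omega)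

/-- A binary form of degree `N` with `N` zeros on the projective line is a multiple of the product
of the corresponding linear forms. -/
theorem eq_C_mul_prod_of_evalLine_eq_zero {N : ℕ} {p : F[X]} (hp : p.natDegree ≤ N)
    {T : Finset (Option F)} (hT : T.card = N) (h : ∀ o ∈ T, evalLine N o p = 0) :
    p = C (p.coeff (Finset.eraseNone T).card) * ∏ x ∈ Finset.eraseNone T, (X - C x) := by
  set T' := Finset.eraseNone T with hT'
  have hmon : (∏ x ∈ T', (X - C x)).Monic := monic_prod_of_monic _ _ fun x _ => monic_X_sub_C x
  have hdeg : (∏ x ∈ T', (X - C x)).natDegree = T'.card := by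
    rw [natDegree_prod_of_monic _ _ fun x _ => monic_X_sub_C x]
    simp
  rw [← sub_eq_zero]
  refine eq_zero_of_degree_lt_of_eval_finset_eq_zero T' ?_ ?_
  · rw [degree_lt_iff_coeff_zero]
    intro m (hm : T'.card ≤ m)
    rw [coeff_sub, coeff_C_mul]
    rcases hm.eq_or_lt with rfl | hm
    · have : (∏ x ∈ T', (X - C x)).coeff T'.card = 1 := by
        rw [← hdeg]
        exact hmon.coeff_natDegree
      rw [this, mul_one, sub_self]
    · rw [coeff_eq_zero_of_evalLine_eq_zero hp h (by rw [← hT']; omega),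
        coeff_eq_zero_of_natDegree_lt (hdeg.trans_lt hm), mul_zero, sub_zero]
  · intro x hx
    rw [eval_sub, eval_eq_zero_of_mem_eraseNone h x hx, eval_mul, eval_prod,
      Finset.prod_eq_zero hx (by simp), mul_zero, sub_zero]

theorem natDegree_le_of_mem_degreeLT {N : ℕ} {p : F[X]} (hp : p ∈ degreeLT F N) :
    p.natDegree ≤ N - 1 := by
  rw [mem_degreeLT, degree_lt_iff_coeff_zero] at hp
  rw [natDegree_le_iff_coeff_eq_zero]
  exact fun m hm => hp m (by omega)

theorem eq_zero_of_mem_degreeLT_zero {p : F[X]} (hp : p ∈ degreeLT F 0) : p = 0 := by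
  rw [mem_degreeLT, degree_lt_iff_coeff_zero] at hp
  ext m
  exact hp m m.zero_le

theorem finrank_degreeLT (N : ℕ) : Module.finrank F (degreeLT F N) = N := by
  rw [(degreeLTEquiv F N).finrank_eq, Module.finrank_fin_fun]

instance finite_degreeLT (N : ℕ) : Module.Finite F (degreeLT F N) :=
  Module.Finite.equiv (degreeLTEquiv F N).symm

section Sum

variable [Fintype F]

/-- The power sums over `F` vanish for exponents below `q - 1` and equal `-1` at `q - 1`. -/
theorem sum_eval_eq_neg_coeff {p : F[X]} (hp : p.natDegree ≤ Fintype.card F - 1) :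
    ∑ x, p.eval x = -p.coeff (Fintype.card F - 1) := by
  classical
  have hq : 1 < Fintype.card F := Fintype.one_lt_card
  have htop : ∑ x : F, x ^ (Fintype.card F - 1) = -1 := by
    have : ∀ x : F, x ^ (Fintype.card F - 1) = 1 - if x = 0 then 1 else 0 := by
      intro x
      split_ifs with hx
      · rw [hx, zero_pow (by omega), sub_self]
      · rw [FiniteField.pow_card_sub_one_eq_one x hx, sub_zero]
    simp [this]
  simp only [eval_eq_sum_range' (show p.natDegree < Fintype.card F by omega)]
  rw [Finset.sum_comm, Finset.sum_eq_single (Fintype.card F - 1)]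
  · rw [← Finset.mul_sum, htop, mul_neg_one]
  · intro i hi hne
    rw [Finset.mem_range] at hi
    rw [← Finset.mul_sum, FiniteField.sum_pow_lt_card_sub_one F i (by omega), mul_zero]
  · intro h
    exact absurd (Finset.mem_range.2 (by omega)) h

/-- Write `p = p₀ + X · divX p`. With `0⁻¹ = 0` the term at zero is absent, which accounts for
`-p₁`; the `p₀` part is a sum of inverses, zero because `q > 2`. -/
theorem sum_inv_mul_eval {p : F[X]} (hq : 2 < Fintype.card F)
    (hp : p.natDegree ≤ Fintype.card F) :
    ∑ x, x⁻¹ * p.eval x = -p.coeff 1 - p.coeff (Fintype.card F) := by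
  classical
  have hpt : ∀ x : F, x⁻¹ * p.eval x =
      p.divX.eval x - (if x = 0 then p.coeff 1 else 0) + x⁻¹ * p.coeff 0 := by
    intro x
    split_ifs with hx
    · rw [hx, ← coeff_zero_eq_eval_zero, ← coeff_zero_eq_eval_zero, coeff_divX]
      simp
    · conv_lhs => rw [← divX_mul_X_add p]
      rw [eval_add, eval_mul, eval_X, eval_C]
      field_simp
      ring
  have hinv : ∑ x : F, x⁻¹ = 0 := by
    rw [← FiniteField.sum_pow_lt_card_sub_one F 1 (by omega)]
    exact Fintype.sum_equiv (Equiv.inv F) _ _ fun x => by simp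
  have hdiv : p.divX.natDegree ≤ Fintype.card F - 1 := by
    rw [natDegree_divX_eq_natDegree_tsub_one]
    omega
  simp only [hpt]
  rw [Finset.sum_add_distrib, Finset.sum_sub_distrib, ← Finset.sum_mul, hinv,
    sum_eval_eq_neg_coeff hdiv, coeff_divX, Nat.sub_add_cancel (by omega)]
  simp
  ring

/-- The map `t ↦ t² - t` sends 0 and 1 to 0; not being injective on a finite set, it is not
surjective. -/
theorem exists_forall_sq_sub_self_ne : ∃ δ : F, ∀ t : F, t ^ 2 - t ≠ δ := by
  by_contra! h
  have hinj : Function.Injective fun t : F => t ^ 2 - t := Finite.injective_iff_surjective.2 h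
  exact zero_ne_one (hinj (by simp) : (0 : F) = 1)

end Sum

/-- The polynomial `c₀ + c₁ X + X² p`, as a linear map. -/
noncomputable def prependCoeffs : (F × F) × F[X] →ₗ[F] F[X] where
  toFun u := C u.1.1 + C u.1.2 * X + X ^ 2 * u.2
  map_add' u v := by
    simp only [Prod.fst_add, Prod.snd_add, C_add]
    ring
  map_smul' c u := by
    simp only [Prod.smul_fst, Prod.smul_snd, smul_eq_mul, C_mul, smul_eq_C_mul, RingHom.id_apply]
    ring

theorem prependCoeffs_apply (u : (F × F) × F[X]) :
    prependCoeffs u = C u.1.1 + C u.1.2 * X + X ^ 2 * u.2 := rfl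

theorem coeff_zero_prependCoeffs (u : (F × F) × F[X]) : (prependCoeffs u).coeff 0 = u.1.1 := by
  simp [prependCoeffs_apply]

theorem coeff_one_prependCoeffs (u : (F × F) × F[X]) : (prependCoeffs u).coeff 1 = u.1.2 := by
  simp [prependCoeffs_apply, coeff_X_pow_mul', coeff_C]

theorem prependCoeffs_eq_zero {u : (F × F) × F[X]} (h : prependCoeffs u = 0) : u = 0 := by
  have h0 : u.1.1 = 0 := by rw [← coeff_zero_prependCoeffs, h, coeff_zero]
  have h1 : u.1.2 = 0 := by rw [← coeff_one_prependCoeffs, h, coeff_zero]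
  obtain ⟨⟨c₀, c₁⟩, p⟩ := u
  simp only at h0 h1
  subst h0 h1
  have : p = 0 := by simpa [prependCoeffs_apply] using h
  rw [this]
  rfl

theorem natDegree_prependCoeffs_le {N : ℕ} (hN : 1 ≤ N) (c : F × F) {p : F[X]}
    (hp : p ∈ degreeLT F (N - 1)) : (prependCoeffs (c, p)).natDegree ≤ N := by
  rw [mem_degreeLT, degree_lt_iff_coeff_zero] at hp
  rw [natDegree_le_iff_coeff_eq_zero]
  intro m hm
  obtain ⟨m, rfl⟩ := Nat.exists_eq_add_of_le (show 2 ≤ m by omega)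
  rw [prependCoeffs_apply, coeff_add, coeff_add, add_comm 2 m, coeff_X_pow_mul, hp m (by omega)]
  simp

end ProjectiveLine

/-! ### The codes of length `q + 1`. -/

variable {F : Type*} [Field F] [Fintype F] [Algebra (ZMod 2) F]

/-- The quantum code obtained by evaluating pairs of binary forms on the projective line. -/
theorem exists_isQuantumMDSCode_of_binaryForms {n D N : ℕ} {U : Type*} [AddCommGroup U]
    [Module F U] [Module.Finite F U] (a b : U →ₗ[F] F[X]) (w : Option F → F) (hw : ∀ o, w o ≠ 0)
    (hn : n = Fintype.card F + 1) (hU : Module.finrank F U = 2 * D) (hD : 2 * D < n)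
    (hiso : ∀ u u', ∑ o, w o * (evalLine N o (a u) * evalLine N o (b u')) =
      ∑ o, w o * (evalLine N o (b u) * evalLine N o (a u')))
    (hmds : ∀ T : Finset (Option F), T.card = D → ∀ u, (∀ o ∈ T, evalLine N o (a u) = 0) →
      (∀ o ∈ T, evalLine N o (b u) = 0) → u = 0) :
    ∃ Q : Submodule ℂ (StateSpace F n), IsQuantumMDSCode 2 Q (n - 2 * D) (D + 1) := by
  let e : Fin n ≃ Option F := Fintype.equivOfCardEq (by rw [Fintype.card_fin, Fintype.card_option, hn])
  refine exists_isQuantumMDSCode_of_isotropic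
    (LinearMap.pi fun i => w (e i) • (evalLine N (e i) ∘ₗ a))
    (LinearMap.pi fun i => evalLine N (e i) ∘ₗ b) hU hD (fun u u' => ?_) fun T hT u hu => ?_
  · refine Eq.trans ?_ ((hiso u u').trans ?_)
    · rw [← Equiv.sum_comp e]
      exact Finset.sum_congr rfl fun i _ => mul_assoc _ _ _
    · rw [← Equiv.sum_comp e]
      exact Finset.sum_congr rfl fun i _ => mul_left_comm _ _ _
  · refine hmds (T.map e.toEmbedding) (by rw [Finset.card_map, hT]) u ?_ ?_
    · intro o ho
      obtain ⟨i, hi, rfl⟩ := Finset.mem_map.1 ho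
      exact (mul_eq_zero.1 (hu i hi).1).resolve_left (hw _)
    · intro o ho
      obtain ⟨i, hi, rfl⟩ := Finset.mem_map.1 ho
      exact (hu i hi).2

theorem exists_monic_irreducible_natDegree_eq {e : ℕ} (he : e ≠ 0) :
    ∃ h : F[X], h.Monic ∧ Irreducible h ∧ h.natDegree = e := by
  have : CharP F 2 := charP_of_injective_algebraMap (algebraMap (ZMod 2) F).injective 2
  have : NeZero e := ⟨he⟩
  obtain ⟨α, hα⟩ := Field.exists_primitive_element F (FiniteField.Extension F 2 e)
  have hint : IsIntegral F α := IsIntegral.of_finite F α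
  exact ⟨minpoly F α, minpoly.monic hint, minpoly.irreducible hint, by
    rw [← IntermediateField.adjoin.finrank hint, hα, IntermediateField.finrank_top',
      FiniteField.finrank_extension]⟩

/-- For `p`, `r` of degree less than `D`, the product `h p r` has degree at most `q - 1`, so its sum
over `F` is minus its top coefficient `p_{D-1} r_{D-1}`, which the point at infinity cancels. Each
component is thus self-orthogonal for the weights, and two independent copies form an isotropic
family. -/
theorem exists_isQuantumMDSCode_of_two_mul_lt {n D : ℕ} (hn : n = Fintype.card F + 1)
    (hD : 2 * D < Fintype.card F) :
    ∃ Q : Submodule ℂ (StateSpace F n), IsQuantumMDSCode 2 Q (n - 2 * D) (D + 1) := by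
  have : CharP F 2 := charP_of_injective_algebraMap (algebraMap (ZMod 2) F).injective 2
  obtain ⟨h, hmon, hirr, hdeg⟩ :=
    exists_monic_irreducible_natDegree_eq (F := F) (e := Fintype.card F + 1 - 2 * D) (by omega)
  have hroot : ∀ x, h.eval x ≠ 0 := fun x hx =>
    hirr.not_isRoot_of_natDegree_ne_one (by omega) hx
  have hsub : ∀ (p : degreeLT F D), (p : F[X]).natDegree ≤ D - 1 := fun p =>
    natDegree_le_of_mem_degreeLT p.2
  have hiso : ∀ p r : degreeLT F D, ∑ o, (o.elim 1 fun x => h.eval x) *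
      (evalLine (D - 1) o (p : F[X]) * evalLine (D - 1) o (r : F[X])) = 0 := by
    intro p r
    -- For `D = 0` the index `D - 1` truncates to 0, but then only the zero polynomial occurs.
    rcases Nat.eq_zero_or_pos D with rfl | hpos
    · simp [eq_zero_of_mem_degreeLT_zero p.2]
    have hpr : ((p : F[X]) * r).natDegree ≤ (D - 1) + (D - 1) :=
      natDegree_mul_le_of_le (hsub p) (hsub r)
    have htot : (h * (p * r)).natDegree ≤ Fintype.card F - 1 :=
      (natDegree_mul_le_of_le hdeg.le hpr).trans (by omega)
    have hsum := sum_eval_eq_neg_coeff htot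
    rw [show Fintype.card F - 1 = (Fintype.card F + 1 - 2 * D) + ((D - 1) + (D - 1)) by omega,
      coeff_mul_add_eq_of_natDegree_le hdeg.le hpr, coeff_mul_add_eq_of_natDegree_le (hsub p) (hsub r), ← hdeg,
      hmon.coeff_natDegree] at hsum
    simp only [eval_mul] at hsum
    rw [Fintype.sum_option]
    simp only [Option.elim_none, Option.elim_some, evalLine_none, evalLine_some, hsum]
    ring
  have hzero : ∀ (T : Finset (Option F)), T.card = D → ∀ p : degreeLT F D,
      (∀ o ∈ T, evalLine (D - 1) o (p : F[X]) = 0) → p = 0 := by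
    intro T hT p hp
    rcases Nat.eq_zero_or_pos D with rfl | hpos
    · exact Subtype.ext (eq_zero_of_mem_degreeLT_zero p.2)
    · exact Subtype.ext (eq_zero_of_evalLine_eq_zero (hsub p) (by omega) hp)
  refine exists_isQuantumMDSCode_of_binaryForms (U := degreeLT F D × degreeLT F D) (N := D - 1)
    ((degreeLT F D).subtype ∘ₗ LinearMap.fst F _ _) ((degreeLT F D).subtype ∘ₗ LinearMap.snd F _ _)
    (fun o => o.elim 1 fun x => h.eval x) ?_ hn ?_ (by omega) (fun u u' => ?_) fun T hT u ha hb => ?_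
  · rintro (_ | x)
    · exact one_ne_zero
    · exact hroot x
  · rw [Module.finrank_prod, finrank_degreeLT, two_mul]
  · exact (hiso u.1 u'.2).trans (hiso u.2 u'.1).symm
  · exact Prod.ext (hzero T hT u.1 ha) (hzero T hT u.2 hb)

/-- The quantum code obtained from the pairs `(a, b)` of polynomials of degree at most `q / 2` with
`a₁ = δ b₀` and `b₁ = a₀ + b₀`, where `X² - X - δ` has no root. -/
theorem exists_isQuantumMDSCode_of_two_mul_eq {n D : ℕ} (hn : n = Fintype.card F + 1)
    (hD : 2 * D = Fintype.card F) (hq : 2 < Fintype.card F) :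
    ∃ Q : Submodule ℂ (StateSpace F n), IsQuantumMDSCode 2 Q (n - 2 * D) (D + 1) := by
  classical
  obtain ⟨δ, hδ⟩ := exists_forall_sq_sub_self_ne (F := F)
  let U := (F × F) × (degreeLT F (D - 1) × degreeLT F (D - 1))
  let a : U →ₗ[F] F[X] := prependCoeffs ∘ₗ LinearMap.prodMap
    ((LinearMap.fst F F F).prod (δ • LinearMap.snd F F F))
    ((degreeLT F (D - 1)).subtype ∘ₗ LinearMap.fst F _ _)
  let b : U →ₗ[F] F[X] := prependCoeffs ∘ₗ LinearMap.prodMap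
    ((LinearMap.snd F F F).prod (LinearMap.fst F F F + LinearMap.snd F F F))
    ((degreeLT F (D - 1)).subtype ∘ₗ LinearMap.snd F _ _)
  have hadeg : ∀ u, (a u).natDegree ≤ D := fun u =>
    natDegree_prependCoeffs_le (by omega) _ u.2.1.2
  have hbdeg : ∀ u, (b u).natDegree ≤ D := fun u =>
    natDegree_prependCoeffs_le (by omega) _ u.2.2.2
  have ha0 : ∀ u, (a u).coeff 0 = u.1.1 := fun u => coeff_zero_prependCoeffs _
  have ha1 : ∀ u, (a u).coeff 1 = δ * u.1.2 := fun u => coeff_one_prependCoeffs _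
  have hb0 : ∀ u, (b u).coeff 0 = u.1.2 := fun u => coeff_zero_prependCoeffs _
  have hb1 : ∀ u, (b u).coeff 1 = u.1.1 + u.1.2 := fun u => coeff_one_prependCoeffs _
  -- The weight is `x⁻¹` off zero, and 1 at zero and at infinity. The term at infinity cancels the
  -- degree `q` coefficient of `p r`, so the pairing depends only on its two lowest coefficients.
  let w : Option F → F := fun o => o.elim 1 fun x => x⁻¹ + if x = 0 then 1 else 0
  have hw : ∀ o, w o ≠ 0 := by
    rintro (_ | x)
    · exact one_ne_zero
    · by_cases hx : x = 0 <;> simp [w, hx]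
  have hsum : ∀ p r : F[X], p.natDegree ≤ D → r.natDegree ≤ D →
      ∑ o, w o * (evalLine D o p * evalLine D o r) = (p * r).coeff 0 - (p * r).coeff 1 := by
    intro p r hp hr
    have hpr : (p * r).natDegree ≤ Fintype.card F :=
      (natDegree_mul_le_of_le hp hr).trans (by omega)
    have h := sum_inv_mul_eval hq hpr
    have htop : (p * r).coeff (Fintype.card F) = p.coeff D * r.coeff D := by
      rw [← hD, two_mul, coeff_mul_add_eq_of_natDegree_le hp hr]
    rw [htop] at h
    rw [Fintype.sum_option]
    simp only [w, Option.elim_none, Option.elim_some, evalLine_none, evalLine_some, ← eval_mul,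
      add_mul, Finset.sum_add_distrib, h, ite_mul, one_mul, zero_mul, Finset.sum_ite_eq',
      Finset.mem_univ, if_true, ← coeff_zero_eq_eval_zero]
    ring
  refine exists_isQuantumMDSCode_of_binaryForms a b (N := D) w hw hn ?_ (by omega)
    (fun u u' => ?_) fun T hT u ha hb => ?_
  · simp only [U, Module.finrank_prod, finrank_degreeLT, Module.finrank_self]
    omega
  -- With the coupling both sides become `-a₀a₀' - δ b₀b₀'`, which is symmetric in `u` and `u'`.
  · rw [hsum _ _ (hadeg u) (hbdeg u'), hsum _ _ (hbdeg u) (hadeg u'), mul_coeff_zero,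
      mul_coeff_zero, mul_coeff_one, mul_coeff_one, ha0, ha1, hb0, hb1, ha0, ha1, hb0, hb1]
    ring
  · have hag := eq_C_mul_prod_of_evalLine_eq_zero (hadeg u) hT ha
    have hbg := eq_C_mul_prod_of_evalLine_eq_zero (hbdeg u) hT hb
    set g : F[X] := ∏ x ∈ Finset.eraseNone T, (X - C x) with hg
    set γ := (a u).coeff (Finset.eraseNone T).card
    set γ' := (b u).coeff (Finset.eraseNone T).card
    have e1 : u.1.1 = γ * g.coeff 0 := by rw [← ha0, hag, coeff_C_mul]
    have e2 : δ * u.1.2 = γ * g.coeff 1 := by rw [← ha1, hag, coeff_C_mul]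
    have e3 : u.1.2 = γ' * g.coeff 0 := by rw [← hb0, hbg, coeff_C_mul]
    have e4 : u.1.1 + u.1.2 = γ' * g.coeff 1 := by rw [← hb1, hbg, coeff_C_mul]
    -- Both polynomials are multiples `γ g`, `γ' g` of one squarefree `g`. If `g₀ = 0` then `g₁ ≠
    -- 0`, and the coupling kills both scalars. Otherwise `t = g₁/g₀` satisfies `γ'(t² - t - δ) =
    -- 0`, so `γ' = 0` by the choice of `δ`, and then `γ = 0`.
    have hγ : γ = 0 ∧ γ' = 0 := by
      by_cases hg0 : g.coeff 0 = 0
      · have hg1 : g.coeff 1 ≠ 0 := by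
          intro hg1
          have hsep : g.Separable := separable_prod_X_sub_C_iff'.2 fun x _ y _ h => h
          have hdvd : X * X ∣ g := by
            rw [← pow_two, X_pow_dvd_iff]
            intro d hd
            interval_cases d
            · exact hg0
            · exact hg1
          exact not_isUnit_X (hsep.squarefree X hdvd)
        rw [hg0, mul_zero] at e1 e3
        rw [e3, mul_zero, eq_comm, mul_eq_zero] at e2
        rw [e1, e3, add_zero, eq_comm, mul_eq_zero] at e4
        exact ⟨e2.resolve_right hg1, e4.resolve_right hg1⟩
      · have key : γ' * ((g.coeff 1 / g.coeff 0) ^ 2 - g.coeff 1 / g.coeff 0 - δ) = 0 := by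
          field_simp
          rw [e1, e3] at e4
          rw [e3] at e2
          linear_combination (-g.coeff 1) * e4 - g.coeff 0 * e2
        have hγ' : γ' = 0 := (mul_eq_zero.1 key).resolve_right (sub_ne_zero.2 (hδ _))
        rw [hγ', zero_mul] at e3 e4
        rw [e3, add_zero, e1, mul_eq_zero] at e4
        exact ⟨e4.resolve_right hg0, hγ'⟩
    have hau := prependCoeffs_eq_zero (hag.trans (by rw [hγ.1, C_0, zero_mul]))
    have hbu := prependCoeffs_eq_zero (hbg.trans (by rw [hγ.2, C_0, zero_mul]))
    simp only [Prod.ext_iff] at hau hbu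
    exact Prod.ext (Prod.ext hau.1.1 hbu.1.1) (Prod.ext (Subtype.ext hau.2) (Subtype.ext hbu.2))

/-- Quantum MDS codes of length `q + 1` over an alphabet of even size `q > 2`. -/
theorem exists_isQuantumMDSCode {n D : ℕ} (hn : n = Fintype.card F + 1)
    (hq : 2 < Fintype.card F) (hD : 2 * D ≤ Fintype.card F) :
    ∃ Q : Submodule ℂ (StateSpace F n), IsQuantumMDSCode 2 Q (n - 2 * D) (D + 1) :=
  hD.lt_or_eq.elim (exists_isQuantumMDSCode_of_two_mul_lt hn)
    fun h => exists_isQuantumMDSCode_of_two_mul_eq hn h hq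

end QuantumMDS

theorem theorem3p5 {F : Type*} [Field F] [Fintype F] [Algebra (ZMod 2) F] :
    (∀ m k : ℕ, 1 < m → Fintype.card F = 2 ^ m →
      2 ^ m + 2 ≤ 2 * k → k ≤ 2 ^ m + 1 →
      ∃ Q : Submodule ℂ (QuantumMDS.StateSpace F (2 ^ m + 1)),
        QuantumMDS.IsQuantumMDSCode 2 Q (2 * k - 2 ^ m - 1) (2 ^ m + 2 - k)) ∧
    (∀ s l : ℕ, 1 ≤ s → l = 2 ^ s → Fintype.card F = l ^ 2 →
      ∃ Q : Submodule ℂ (QuantumMDS.StateSpace F (l ^ 2 + 1)),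
        QuantumMDS.IsQuantumMDSCode 2 Q (l ^ 2 + 3 - 2 * l) l) := by
  constructor
  · intro m k hm hF hk hk'
    have hq : 2 ^ 2 ≤ 2 ^ m := Nat.pow_le_pow_right (by norm_num) hm
    have h := QuantumMDS.exists_isQuantumMDSCode (F := F) (n := 2 ^ m + 1) (D := 2 ^ m + 1 - k)
      (by rw [hF]) (by omega) (by omega)
    convert h using 3 <;> omega
  · intro s l hs hl hF
    have hl2 : 2 ^ 1 ≤ l := hl ▸ Nat.pow_le_pow_right (by norm_num) hs
    have hll : 2 * l ≤ l ^ 2 := by nlinarith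
    -- Distance `l` means `D = l - 1`, and `2(l - 1) ≤ l²` lies in the range of the same
    -- construction.
    have h := QuantumMDS.exists_isQuantumMDSCode (F := F) (n := l ^ 2 + 1) (D := l - 1)
      (by rw [hF]) (by omega) (by omega)
    convert h using 3 <;> omega
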